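/- All digraphs are finite and may have loops, parallel edges and anti-parallel edges. A \emph{cut} of a digraph $D$ is a non-empty set $D[X,Y]$ of all edges with one endpoint in $X$ and the other in $Y$, where $(X,Y)$ is a partition of $V(D)$; it is a \emph{bond} if it contains no other cut properly, and it is \emph{directed} if (for one of the two orderings of the parts) no edge has its tail in $Y$ and its head in $X$. An \emph{odd dijoin} of $D$ is a set $J\subseteq E(D)$ such that $|J\cap S|$ is odd for every directed bond $S$ of $D$. A non-loop edge $e=(x,y)$ is \emph{deletable} if $D$ has a directed path from $x$ to $y$ that does not use $e$. A \emph{cut minor} of $D$ is a digraph obtained from $D$ by a finite series of contractions of edges (where contracting an edge means deleting it and identifying its endpoints), deletions of deletable edges, and deletions of isolated vertices; it is \emph{proper} if at least one such operation is carried out. A \emph{minimal obstruction} is a digraph that has no odd dijoin, but all of whose proper cut minors have an odd dijoin. For integers $n_1,n_2,n_3\ge 0$ let $\mathcal D(n_1,n_2,n_3)$ be the digraph whose vertex set is the disjoint union of layers $V_0,V_1,V_2$ with $|V_0|=n_1$, $|V_1|=n_2$, $|V_2|=n_3$, and whose edge set is $(V_0\times V_1)\mathbin{\dot\cup}(V_1\times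 V_2)$, each pair $(a,b)$ being a single edge with tail $a$ and head $b$. \textbf{Proposition.} Every minimal obstruction $D$ is isomorphic to $\mathcal D(n_1,n_2,n_3)$ for some integers $n_1,n_2,n_3\ge 0$. -/

import Mathlib

universe u v u₁ v₁ u₂ v₂

/-- A finite digraph. Loops, parallel edges and anti-parallel edges are allowed: edges form a type
of their own, and each edge has a tail and a head. -/
structure FinDigraph : Type (max (u + 1) (v + 1)) where
  /-- the vertices -/
  V : Type u
  /-- the directed edges -/
  E : Type v
  finite_V : Finite V
  finite_E : Finite E
  tail : E → V
  head : E → V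

namespace FinDigraph

attribute [instance] FinDigraph.finite_V FinDigraph.finite_E

/-- `D.cutEdges X` is the set `D[X, V \ X]` of edges with one endpoint in `X` and one endpoint
outside `X`. -/
def cutEdges (D : FinDigraph.{u, v}) (X : Set D.V) : Set D.E :=
  {e | (D.tail e ∈ X ∧ D.head e ∉ X) ∨ (D.tail e ∉ X ∧ D.head e ∈ X)}

/-- A cut is a non-empty edge set of the form `D[X, V \ X]`. -/
def IsCut (D : FinDigraph.{u, v}) (S : Set D.E) : Prop :=
  S.Nonempty ∧ ∃ X : Set D.V, S = D.cutEdges X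

/-- A bond is a cut that contains no other cut properly. -/
def IsBond (D : FinDigraph.{u, v}) (S : Set D.E) : Prop :=
  D.IsCut S ∧ ∀ T : Set D.E, D.IsCut T → ¬ T ⊂ S

/-- A directed cut is a cut `D[X, V \ X]` such that no edge has its head in `X` and its tail
outside `X`. -/
def IsDirectedCut (D : FinDigraph.{u, v}) (S : Set D.E) : Prop :=
  S.Nonempty ∧ ∃ X : Set D.V, S = D.cutEdges X ∧ ∀ e : D.E, D.head e ∈ X → D.tail e ∈ X

/-- A directed bond is a bond that is a directed cut. -/
def IsDirectedBond (D : FinDigraph.{u, v}) (S : Set D.E) : Prop :=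
  D.IsBond S ∧ D.IsDirectedCut S

/-- An odd dijoin is an edge set that meets every directed bond in an odd number of edges. -/
def IsOddDijoin (D : FinDigraph.{u, v}) (J : Set D.E) : Prop :=
  ∀ S : Set D.E, D.IsDirectedBond S → Odd (J ∩ S).ncard

/-- The digraph has an odd dijoin. -/
def HasOddDijoin (D : FinDigraph.{u, v}) : Prop :=
  ∃ J : Set D.E, D.IsOddDijoin J

/-- The contraction `D / A`: the edges of `A` are deleted, and the two endpoints of each edge of `A`
are identified. `Quot` identifies along the equivalence relation that the given relation generates,
so the vertices of `D / A` are the weak components of the digraph with vertex set `V` and edge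
set `A`. -/
def contract (D : FinDigraph.{u, v}) (A : Set D.E) : FinDigraph.{u, v} where
  V := Quot fun x y : D.V => ∃ a ∈ A, D.tail a = x ∧ D.head a = y
  E := {e : D.E // e ∉ A}
  finite_V := inferInstance
  finite_E := inferInstance
  tail e := Quot.mk _ (D.tail e.1)
  head e := Quot.mk _ (D.head e.1)

/-- The digraph `D - e`. -/
def deleteEdge (D : FinDigraph.{u, v}) (e : D.E) : FinDigraph.{u, v} where
  V := D.V
  E := {f : D.E // f ≠ e}
  finite_V := inferInstance
  finite_E := inferInstance
  tail f := D.tail f.1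
  head f := D.head f.1

/-- A vertex is isolated if it is not an endpoint of any edge. -/
def IsIsolated (D : FinDigraph.{u, v}) (x : D.V) : Prop :=
  ∀ e : D.E, D.tail e ≠ x ∧ D.head e ≠ x

/-- The digraph `D - x`, for an isolated vertex `x`. -/
def deleteIsolated (D : FinDigraph.{u, v}) (x : D.V) (hx : D.IsIsolated x) :
    FinDigraph.{u, v} where
  V := {y : D.V // y ≠ x}
  E := D.E
  finite_V := inferInstance
  finite_E := inferInstance
  tail e := ⟨D.tail e, (hx e).1⟩
  head e := ⟨D.head e, (hx e).2⟩

/-- An edge `e` is deletable if it is not a loop and its head can be reached from its tail along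
edges other than `e`. (A directed walk that avoids `e` contains a directed path that avoids `e`.) -/
def IsDeletable (D : FinDigraph.{u, v}) (e : D.E) : Prop :=
  D.tail e ≠ D.head e ∧
    Relation.ReflTransGen (fun x y : D.V => ∃ f : D.E, f ≠ e ∧ D.tail f = x ∧ D.head f = y)
      (D.tail e) (D.head e)

/-- `CutMinorStep D D'`: the digraph `D'` arises from `D` by contracting one edge, by deleting one
deletable edge, or by deleting one isolated vertex. -/
inductive CutMinorStep : FinDigraph.{u, v} → FinDigraph.{u, v} → Prop
  | contract (D : FinDigraph.{u, v}) (e : D.E) : CutMinorStep D (D.contract {e})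
  | deleteEdge (D : FinDigraph.{u, v}) (e : D.E) (he : D.IsDeletable e) :
      CutMinorStep D (D.deleteEdge e)
  | deleteIsolated (D : FinDigraph.{u, v}) (x : D.V) (hx : D.IsIsolated x) :
      CutMinorStep D (D.deleteIsolated x hx)

/-- `D'` is a proper cut minor of `D`: it arises from `D` by a finite series of at least one step.
(Every step lowers the number of vertices and edges.) -/
def IsProperCutMinor (D' D : FinDigraph.{u, v}) : Prop :=
  Relation.TransGen CutMinorStep D D'

/-- A minimal obstruction has no odd dijoin, but all its proper cut minors have one. -/
def IsMinimalObstruction (D : FinDigraph.{u, v}) : Prop :=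
  ¬ D.HasOddDijoin ∧ ∀ D' : FinDigraph.{u, v}, D'.IsProperCutMinor D → D'.HasOddDijoin

/-- An isomorphism of digraphs: bijections of the vertices and of the edges that respect tails and
heads. -/
structure Iso (D₁ : FinDigraph.{u₁, v₁}) (D₂ : FinDigraph.{u₂, v₂}) where
  vertexEquiv : D₁.V ≃ D₂.V
  edgeEquiv : D₁.E ≃ D₂.E
  tail_eq : ∀ e : D₁.E, D₂.tail (edgeEquiv e) = vertexEquiv (D₁.tail e)
  head_eq : ∀ e : D₁.E, D₂.head (edgeEquiv e) = vertexEquiv (D₁.head e)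

/-- The digraph `𝒟(n₀, n₁, n₂)`: its vertex set is the disjoint union of layers `V₀`, `V₁`, `V₂` with
`n₀`, `n₁`, `n₂` elements, and its edge set is the disjoint union of `V₀ × V₁` and `V₁ × V₂`. -/
def layered (n₀ n₁ n₂ : ℕ) : FinDigraph.{0, 0} where
  V := Fin n₀ ⊕ Fin n₁ ⊕ Fin n₂
  E := (Fin n₀ × Fin n₁) ⊕ (Fin n₁ × Fin n₂)
  finite_V := inferInstance
  finite_E := inferInstance
  tail := Sum.elim (fun p => Sum.inl p.1) (fun p => Sum.inr (Sum.inl p.1))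
  head := Sum.elim (fun p => Sum.inr (Sum.inl p.2)) (fun p => Sum.inr (Sum.inr p.2))

end FinDigraph

namespace FinDigraph

section Weight

variable {α : Type*}

/-- The sum modulo two of the weights of the elements of a set. -/
noncomputable def weight (w : α → ZMod 2) (X : Set α) : ZMod 2 := ∑ᶠ x ∈ X, w x

lemma weight_union [Finite α] (w : α → ZMod 2) {X Y : Set α} (h : Disjoint X Y) :
    weight w (X ∪ Y) = weight w X + weight w Y :=
  finsum_mem_union h (Set.toFinite _) (Set.toFinite _)

lemma weight_union_add_inter [Finite α] (w : α → ZMod 2) (X Y : Set α) :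
    weight w (X ∪ Y) + weight w (X ∩ Y) = weight w X + weight w Y :=
  finsum_mem_union_inter (Set.toFinite _) (Set.toFinite _)

lemma weight_add_compl [Finite α] (w : α → ZMod 2) (X : Set α) :
    weight w X + weight w Xᶜ = weight w Set.univ := by
  rw [← weight_union w disjoint_compl_right, Set.union_compl_self]

lemma weight_congr {w w' : α → ZMod 2} {X : Set α} (h : ∀ x ∈ X, w x = w' x) :
    weight w X = weight w' X :=
  finsum_mem_congr rfl h

lemma weight_add [Finite α] (w w' : α → ZMod 2) (X : Set α) :
    weight (w + w') X = weight w X + weight w' X :=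
  finsum_mem_add_distrib (Set.toFinite _)

@[simp] lemma weight_zero (X : Set α) : weight (0 : α → ZMod 2) X = 0 := by
  simp [weight]

open Classical in
lemma weight_single [Finite α] (x : α) (X : Set α) :
    weight (Pi.single x 1) X = if x ∈ X then 1 else 0 := by
  have := Fintype.ofFinite α
  rw [weight, finsum_mem_eq_finite_toFinset_sum _ (Set.toFinite X)]
  simp

lemma weight_eq_ncard [Finite α] (w : α → ZMod 2) (X : Set α) :
    weight w X = (({x | w x = 1} ∩ X).ncard : ZMod 2) := by
  classical
  have h : ∀ a : ZMod 2, a = if a = 1 then 1 else 0 := by decide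
  rw [weight, finsum_mem_eq_finite_toFinset_sum _ (Set.toFinite X),
    Finset.sum_congr rfl fun x _ => h (w x), Finset.sum_boole, ← Set.ncard_coe_finset]
  congr 2
  ext x
  simp [and_comm]

lemma weight_sUnion [Finite α] (w : α → ZMod 2) {𝒞 : Set (Set α)} (hd : 𝒞.PairwiseDisjoint id)
    (h : ∀ C ∈ 𝒞, weight w C = 1) : weight w (⋃₀ 𝒞) = (𝒞.ncard : ZMod 2) := by
  rw [weight, finsum_mem_sUnion hd (Set.toFinite _) fun _ _ => Set.toFinite _]
  refine (finsum_mem_congr rfl h).trans ?_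
  have := weight_eq_ncard (fun _ : Set α => (1 : ZMod 2)) 𝒞
  simpa [weight] using this

end Weight

variable (D : FinDigraph.{u, v})

/-- A set of vertices is an ideal if no edge enters it. -/
def IsIdeal (X : Set D.V) : Prop := ∀ e : D.E, D.head e ∈ X → D.tail e ∈ X

variable {D}

lemma mem_cutEdges {X : Set D.V} {e : D.E} :
    e ∈ D.cutEdges X ↔ ¬ (D.tail e ∈ X ↔ D.head e ∈ X) := by
  simp only [cutEdges, Set.mem_ofPred_eq]
  tauto

lemma cutEdges_compl (X : Set D.V) : D.cutEdges Xᶜ = D.cutEdges X := by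
  ext e
  simp only [mem_cutEdges, Set.mem_compl_iff]
  tauto

lemma isDirectedBond_iff {S : Set D.E} :
    D.IsDirectedBond S ↔ S.Nonempty ∧ (∃ X, D.IsIdeal X ∧ S = D.cutEdges X) ∧
      ∀ Y, (D.cutEdges Y).Nonempty → D.cutEdges Y ⊆ S → S ⊆ D.cutEdges Y := by
  constructor
  · rintro ⟨⟨-, h⟩, hS, X, rfl, hX⟩
    refine ⟨hS, ⟨X, hX, rfl⟩, fun Y hY hYX => ?_⟩
    by_contra hXY
    exact h _ ⟨hY, Y, rfl⟩ ⟨hYX, hXY⟩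
  · rintro ⟨hS, ⟨X, hX, rfl⟩, h⟩
    refine ⟨⟨⟨hS, X, rfl⟩, ?_⟩, hS, X, rfl, hX⟩
    rintro _ ⟨hY, Y, rfl⟩ hYX
    exact hYX.2 (h Y hY hYX.1)

/-- The inclusion of the edges of a contraction. -/
def contractEdge (D : FinDigraph.{u, v}) (A : Set D.E) (f : (D.contract A).E) : D.E := f.1

/-- The projection to the vertices of a contraction. -/
def contractVertex (D : FinDigraph.{u, v}) (A : Set D.E) (x : D.V) : (D.contract A).V :=
  Quot.mk _ x

/-- The inclusion of the edges of `D - e`. -/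
def deleteEdgeEdge (D : FinDigraph.{u, v}) (e : D.E) (f : (D.deleteEdge e).E) : D.E := f.1

/-- The inclusion of the vertices of `D - x`. -/
def deleteIsolatedVertex (D : FinDigraph.{u, v}) (x : D.V) (hx : D.IsIsolated x)
    (y : (D.deleteIsolated x hx).V) : D.V := y.1

lemma contractEdge_injective (A : Set D.E) : (D.contractEdge A).Injective :=
  Subtype.val_injective

lemma deleteEdgeEdge_injective (e : D.E) : (D.deleteEdgeEdge e).Injective :=
  Subtype.val_injective

lemma IsDirectedBond.contract {S : Set D.E} (hS : D.IsDirectedBond S) {e : D.E} (he : e ∉ S) :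
    (D.contract {e}).IsDirectedBond (D.contractEdge {e} ⁻¹' S) := by
  obtain ⟨⟨f, hf⟩, ⟨X, hX, rfl⟩, hmin⟩ := isDirectedBond_iff.1 hS
  refine isDirectedBond_iff.2 ⟨⟨⟨f, fun h => he (h ▸ hf)⟩, hf⟩, ?_, ?_⟩
  · refine ⟨{q | Quot.lift (· ∈ X) ?_ q}, fun f hf => hX f.1 hf, rfl⟩
    rintro _ _ ⟨_, rfl, rfl, rfl⟩
    rw [mem_cutEdges, not_not] at he
    exact propext he
  · intro Y ⟨g, hg⟩ hY f hf
    refine hmin (D.contractVertex {e} ⁻¹' Y) ⟨g.1, hg⟩ (fun f' hf' => ?_) hf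
    refine @hY ⟨f', fun h => ?_⟩ hf'
    obtain rfl : f' = e := h
    have : D.contractVertex {f'} (D.tail f') = D.contractVertex {f'} (D.head f') :=
      Quot.sound ⟨f', rfl, rfl, rfl⟩
    rw [mem_cutEdges, Set.mem_preimage, Set.mem_preimage] at hf'
    exact hf' (by rw [this])

lemma ncard_image_inter {α β : Type*} {f : α → β} (hf : f.Injective) (J : Set α) (S : Set β) :
    (f '' J ∩ S).ncard = (J ∩ f ⁻¹' S).ncard := by
  rw [← Set.image_inter_preimage, Set.ncard_image_of_injective _ hf]

/-- If all proper cut minors of a digraph have odd dijoins, then some edge set meets every directed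
bond that avoids a given non-empty edge set in an odd number of edges. -/
lemma exists_odd_of_disjoint (hD : ∀ D' : FinDigraph.{u, v}, D'.IsProperCutMinor D →
    D'.HasOddDijoin) (A : Set D.E) (hA : A.Nonempty) :
    ∃ J : Set D.E, ∀ S, D.IsDirectedBond S → Disjoint S A → Odd (J ∩ S).ncard := by
  induction hn : A.ncard using Nat.strong_induction_on generalizing D with
  | _ n ih =>
    obtain ⟨e, he⟩ := hA
    have step := CutMinorStep.contract D e
    have key : ∃ J : Set (D.contract {e}).E, ∀ S, (D.contract {e}).IsDirectedBond S →
        Disjoint S (D.contractEdge {e} ⁻¹' A) → Odd (J ∩ S).ncard := by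
      rcases (D.contractEdge {e} ⁻¹' A).eq_empty_or_nonempty with h | h
      · obtain ⟨J, hJ⟩ := hD _ (.single step)
        exact ⟨J, fun S hS _ => hJ S hS⟩
      · refine ih _ ?_ (fun D' hD' => hD D' (.head step hD')) _ h rfl
        rw [← hn, ← Set.ncard_image_of_injective _ (contractEdge_injective {e})]
        refine Set.ncard_lt_ncard ⟨Set.image_preimage_subset _ _, fun h => ?_⟩
        obtain ⟨f, -, hf⟩ := h he
        exact f.2 hf
    obtain ⟨J, hJ⟩ := key
    refine ⟨D.contractEdge {e} '' J, fun S hS hSA => ?_⟩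
    rw [ncard_image_inter (contractEdge_injective _)]
    exact hJ _ (hS.contract fun h => hSA.le_bot ⟨h, he⟩) (hSA.preimage _)

/-- One vertex reaches another if there is a directed walk from the first to the second. -/
def Reaches (D : FinDigraph.{u, v}) : D.V → D.V → Prop :=
  Relation.ReflTransGen fun x y => ∃ e : D.E, D.tail e = x ∧ D.head e = y

lemma reaches_edge (e : D.E) : D.Reaches (D.tail e) (D.head e) := .single ⟨e, rfl, rfl⟩

lemma IsIdeal.mem_of_reaches {X : Set D.V} (hX : D.IsIdeal X) {x y : D.V} (h : D.Reaches x y)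
    (hy : y ∈ X) : x ∈ X := by
  induction h with
  | refl => exact hy
  | tail _ h ih =>
    obtain ⟨e, rfl, rfl⟩ := h
    exact ih (hX e hy)

lemma IsDirectedBond.deleteEdge {S : Set D.E} (hS : D.IsDirectedBond S) {e : D.E}
    (he : D.IsDeletable e) : (D.deleteEdge e).IsDirectedBond (D.deleteEdgeEdge e ⁻¹' S) := by
  obtain ⟨⟨f, hf⟩, ⟨X, hX, rfl⟩, hmin⟩ := isDirectedBond_iff.1 hS
  have cross : ∀ (Y : Set D.V) {x y : D.V}, Relation.ReflTransGen
      (fun x y : D.V => ∃ f : D.E, f ≠ e ∧ D.tail f = x ∧ D.head f = y) x y →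
      ¬ (x ∈ Y ↔ y ∈ Y) → ∃ f ≠ e, f ∈ D.cutEdges Y ∧
        D.Reaches x (D.tail f) ∧ D.Reaches (D.head f) y := by
    intro Y x y h hxy
    induction h with
    | refl => exact absurd Iff.rfl hxy
    | @tail b c hb h ih =>
      obtain ⟨g, hg, rfl, rfl⟩ := h
      by_cases hbY : x ∈ Y ↔ D.tail g ∈ Y
      · exact ⟨g, hg, mem_cutEdges.2 fun h => hxy (hbY.trans h),
          Relation.ReflTransGen.mono (fun _ _ ⟨f, hf⟩ => ⟨f, hf.2⟩) _ _ hb, .refl⟩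
      · obtain ⟨f, hf, h1, h2, h3⟩ := ih hbY
        exact ⟨f, hf, h1, h2, h3.tail ⟨g, rfl, rfl⟩⟩
  refine isDirectedBond_iff.2 ⟨?_, ⟨X, fun f hf => hX f.1 hf, rfl⟩, ?_⟩
  · by_cases hfe : f = e
    · subst hfe
      obtain ⟨g, hg, hgX, -⟩ := cross X he.2 (mem_cutEdges.1 hf)
      exact ⟨⟨g, hg⟩, hgX⟩
    · exact ⟨⟨f, hfe⟩, hf⟩
  · intro Y ⟨g, hg⟩ hY f hf
    refine hmin Y ⟨g.1, hg⟩ (fun f' hf' => ?_) hf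
    by_cases hfe : f' = e
    · subst hfe
      by_contra hfX
      rw [mem_cutEdges, not_not] at hfX
      obtain ⟨g, hg, hgY, h1, h2⟩ := cross Y he.2 (mem_cutEdges.1 hf')
      have hgX : g ∈ D.cutEdges X := @hY ⟨g, hg⟩ hgY
      rw [mem_cutEdges] at hgX
      refine hgX ⟨fun h => ?_, hX g⟩
      exact hX.mem_of_reaches h2 (hfX.1 (hX.mem_of_reaches h1 h))
    · exact @hY ⟨f', hfe⟩ hf'

lemma IsDirectedBond.deleteIsolated {S : Set D.E} (hS : D.IsDirectedBond S) {x : D.V}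
    (hx : D.IsIsolated x) : (D.deleteIsolated x hx).IsDirectedBond S := by
  obtain ⟨hne, ⟨X, hX, rfl⟩, hmin⟩ := isDirectedBond_iff.1 hS
  refine isDirectedBond_iff.2 ⟨hne, ⟨Subtype.val ⁻¹' X, fun f hf => hX f hf, rfl⟩, ?_⟩
  intro Y hY hYX
  have : (D.deleteIsolated x hx).cutEdges Y = D.cutEdges (D.deleteIsolatedVertex x hx '' Y) := by
    have h : ∀ y hy, y ∈ D.deleteIsolatedVertex x hx '' Y ↔
        (⟨y, hy⟩ : {y // y ≠ x}) ∈ Y := fun y hy =>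
      ⟨by rintro ⟨z, hz, rfl⟩; exact hz, fun h => ⟨_, h, rfl⟩⟩
    ext f
    refine (mem_cutEdges (D := D.deleteIsolated x hx)).trans
      (Iff.trans ?_ (mem_cutEdges (D := D)).symm)
    rw [h _ (hx f).1, h _ (hx f).2]
    rfl
  rw [this] at hY hYX ⊢
  exact hmin _ hY hYX

namespace IsMinimalObstruction

lemma exists_odd_of_disjoint (hD : D.IsMinimalObstruction) {A : Set D.E} (hA : A.Nonempty) :
    ∃ J : Set D.E, ∀ S, D.IsDirectedBond S → Disjoint S A → Odd (J ∩ S).ncard :=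
  FinDigraph.exists_odd_of_disjoint hD.2 A hA

lemma exists_mem_directedBond (hD : D.IsMinimalObstruction) (e : D.E) :
    ∃ S, D.IsDirectedBond S ∧ e ∈ S := by
  by_contra! h
  obtain ⟨J, hJ⟩ := hD.exists_odd_of_disjoint (Set.singleton_nonempty e)
  exact hD.1 ⟨J, fun S hS => hJ S hS (Set.disjoint_singleton_right.2 (h S hS))⟩

lemma not_reaches (hD : D.IsMinimalObstruction) (e : D.E) :
    ¬ D.Reaches (D.head e) (D.tail e) := by
  intro h
  obtain ⟨S, hS, he⟩ := hD.exists_mem_directedBond e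
  obtain ⟨-, ⟨X, hX, rfl⟩, -⟩ := isDirectedBond_iff.1 hS
  exact mem_cutEdges.1 he ⟨hX.mem_of_reaches h, hX e⟩

lemma not_isDeletable (hD : D.IsMinimalObstruction) (e : D.E) : ¬ D.IsDeletable e := by
  intro he
  obtain ⟨J, hJ⟩ := hD.2 _ (.single (.deleteEdge D e he))
  refine hD.1 ⟨D.deleteEdgeEdge e '' J, fun S hS => ?_⟩
  rw [ncard_image_inter (deleteEdgeEdge_injective e)]
  exact hJ _ (hS.deleteEdge he)

lemma not_isIsolated (hD : D.IsMinimalObstruction) (x : D.V) : ¬ D.IsIsolated x := by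
  intro hx
  obtain ⟨J, hJ⟩ := hD.2 _ (.single (.deleteIsolated D x hx))
  exact hD.1 ⟨J, fun S hS => hJ _ (hS.deleteIsolated hx)⟩

lemma nonempty (hD : D.IsMinimalObstruction) : Nonempty D.V := by
  by_contra h
  refine hD.1 ⟨∅, fun S hS => ?_⟩
  obtain ⟨e, -⟩ := hS.1.1.1
  exact absurd ⟨D.tail e⟩ h

end IsMinimalObstruction

/-- `T` is closed in `Y` if no edge of `D[Y]` has exactly one endpoint in `T`. -/
def IsClosedIn (D : FinDigraph.{u, v}) (T Y : Set D.V) : Prop :=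
  ∀ e : D.E, D.tail e ∈ Y → D.head e ∈ Y → (D.tail e ∈ T ↔ D.head e ∈ T)

/-- `Y` is non-empty and induces a weakly connected digraph. -/
def IsConn (D : FinDigraph.{u, v}) (Y : Set D.V) : Prop :=
  Y.Nonempty ∧ ∀ T, D.IsClosedIn T Y → (Y ∩ T).Nonempty → Y ⊆ T

/-- The vertex sets of the weak components of `D[Y]`. -/
def components (D : FinDigraph.{u, v}) (Y : Set D.V) : Set (Set D.V) :=
  {C | C ⊆ Y ∧ D.IsConn C ∧ D.IsClosedIn C Y}

lemma IsClosedIn.mono {T Y Y' : Set D.V} (h : D.IsClosedIn T Y) (hY : Y' ⊆ Y) :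
    D.IsClosedIn T Y' :=
  fun e h1 h2 => h e (hY h1) (hY h2)

lemma IsClosedIn.compl {T Y : Set D.V} (h : D.IsClosedIn T Y) : D.IsClosedIn Tᶜ Y :=
  fun e h1 h2 => not_congr (h e h1 h2)

lemma IsConn.union {A B : Set D.V} (hA : D.IsConn A) (hB : D.IsConn B) (h : (A ∩ B).Nonempty) :
    D.IsConn (A ∪ B) := by
  refine ⟨hA.1.mono Set.subset_union_left, fun T hT hne => ?_⟩
  have hTA := hA.2 T (hT.mono Set.subset_union_left)
  have hTB := hB.2 T (hT.mono Set.subset_union_right)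
  obtain ⟨x, hxA, hxB⟩ := h
  obtain ⟨y, hyA | hyB, hyT⟩ := hne
  · have := hTA ⟨y, hyA, hyT⟩
    exact Set.union_subset this (hTB ⟨x, hxB, this hxA⟩)
  · have := hTB ⟨y, hyB, hyT⟩
    exact Set.union_subset (hTA ⟨x, hxA, this hxB⟩) this

lemma exists_component {Y : Set D.V} {x : D.V} (hx : x ∈ Y) : ∃ C ∈ D.components Y, x ∈ C := by
  let C : Set D.V := {y | y ∈ Y ∧ ∀ T, x ∈ T → D.IsClosedIn T Y → y ∈ T}
  have hCY : D.IsClosedIn C Y := fun e h1 h2 =>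
    ⟨fun h => ⟨h2, fun T hT hTY => (hTY e h1 h2).1 (h.2 T hT hTY)⟩,
      fun h => ⟨h1, fun T hT hTY => (hTY e h1 h2).2 (h.2 T hT hTY)⟩⟩
  have hxC : x ∈ C := ⟨hx, fun T hT _ => hT⟩
  have key : ∀ T, D.IsClosedIn T C → x ∈ T → C ⊆ T := by
    intro T hT hxT y hy
    refine (hy.2 (C ∩ T) ⟨hxC, hxT⟩ fun e h1 h2 => ?_).2
    constructor
    · rintro ⟨h3, h4⟩
      have h5 := (hCY e h1 h2).1 h3
      exact ⟨h5, (hT e h3 h5).1 h4⟩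
    · rintro ⟨h3, h4⟩
      have h5 := (hCY e h1 h2).2 h3
      exact ⟨h5, (hT e h5 h3).2 h4⟩
  refine ⟨C, ⟨fun y hy => hy.1, ⟨⟨x, hxC⟩, fun T hT ⟨z, hzC, hzT⟩ => ?_⟩, hCY⟩, hxC⟩
  by_cases hxT : x ∈ T
  · exact key T hT hxT
  · exact absurd hzT (key _ hT.compl hxT hzC)

lemma sUnion_components (Y : Set D.V) : ⋃₀ D.components Y = Y := by
  refine Set.Subset.antisymm (Set.sUnion_subset fun C hC => hC.1) fun x hx => ?_
  obtain ⟨C, hC, hxC⟩ := exists_component hx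
  exact ⟨C, hC, hxC⟩

lemma pairwiseDisjoint_components (Y : Set D.V) : (D.components Y).PairwiseDisjoint id := by
  intro A hA B hB hAB
  rw [Function.onFun, id, id, Set.disjoint_iff_inter_eq_empty]
  by_contra h
  have hne := Set.nonempty_iff_ne_empty.2 h
  refine hAB (Set.Subset.antisymm ?_ ?_)
  · exact hA.2.1.2 B (hB.2.2.mono hA.1) hne
  · exact hB.2.1.2 A (hA.2.2.mono hB.1) (Set.inter_comm A B ▸ hne)

lemma isConn_compl_of_mem_components (hD : D.IsConn Set.univ) {Y C : Set D.V}
    (hY : D.IsConn Yᶜ) (hC : C ∈ D.components Y) : D.IsConn Cᶜ := by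
  have key : ∀ T, D.IsClosedIn T Cᶜ → (Cᶜ ∩ T).Nonempty → (Yᶜ ∩ T).Nonempty := by
    intro T hT hne
    by_contra h
    have hTY : ∀ x ∈ T, x ∈ Y := fun x hx => by_contra fun hxY => h ⟨x, hxY, hx⟩
    have hcl : D.IsClosedIn (Cᶜ ∩ T) Set.univ := by
      intro e _ _
      constructor
      · rintro ⟨h1, h2⟩
        have h3 : D.head e ∉ C := fun h3 => h1 ((hC.2.2 e (hTY _ h2) (hC.1 h3)).2 h3)
        exact ⟨h3, (hT e h1 h3).1 h2⟩
      · rintro ⟨h1, h2⟩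
        have h3 : D.tail e ∉ C := fun h3 => h1 ((hC.2.2 e (hC.1 h3) (hTY _ h2)).1 h3)
        exact ⟨h3, (hT e h3 h1).2 h2⟩
    obtain ⟨y, hy⟩ := hY.1
    have := hD.2 _ hcl (by rwa [Set.univ_inter])
    exact hy (hTY y (this (Set.mem_univ y)).2)
  have hYC : Yᶜ ⊆ Cᶜ := Set.compl_subset_compl.2 hC.1
  refine ⟨hY.1.mono hYC, fun T hT hne => ?_⟩
  by_contra hCT
  obtain ⟨x, hx, hxT⟩ := Set.not_subset.1 hCT
  obtain ⟨y, hy, hyT⟩ := key _ hT.compl ⟨x, hx, hxT⟩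
  exact hyT (hY.2 T (hT.mono hYC) (key T hT hne) hy)

/-- The vertices that reach `x`. -/
def lowerSet (D : FinDigraph.{u, v}) (x : D.V) : Set D.V := {y | D.Reaches y x}

/-- The vertices that `x` reaches. -/
def upperSet (D : FinDigraph.{u, v}) (x : D.V) : Set D.V := {y | D.Reaches x y}

lemma isIdeal_lowerSet (x : D.V) : D.IsIdeal (D.lowerSet x) := fun e h => h.head ⟨e, rfl, rfl⟩

lemma isConn_lowerSet (x : D.V) : D.IsConn (D.lowerSet x) := by
  have key : ∀ T, D.IsClosedIn T (D.lowerSet x) → ∀ y ∈ D.lowerSet x, (y ∈ T ↔ x ∈ T) := by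
    intro T hT y hy
    induction hy using Relation.ReflTransGen.head_induction_on with
    | refl => rfl
    | head h h' ih =>
      obtain ⟨e, rfl, rfl⟩ := h
      rw [← ih]
      exact hT e (h'.head ⟨e, rfl, rfl⟩) h'
  refine ⟨⟨x, .refl⟩, fun T hT ⟨y, hy, hyT⟩ z hz => ?_⟩
  rw [key T hT z hz, ← key T hT y hy]
  exact hyT

lemma isConn_upperSet (x : D.V) : D.IsConn (D.upperSet x) := by
  have key : ∀ T, D.IsClosedIn T (D.upperSet x) → ∀ y ∈ D.upperSet x, (y ∈ T ↔ x ∈ T) := by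
    intro T hT y hy
    induction hy with
    | refl => rfl
    | tail h' h ih =>
      obtain ⟨e, rfl, rfl⟩ := h
      rw [← ih]
      exact (hT e h' (h'.tail ⟨e, rfl, rfl⟩)).symm
  refine ⟨⟨x, .refl⟩, fun T hT ⟨y, hy, hyT⟩ z hz => ?_⟩
  rw [key T hT z hz, ← key T hT y hy]
  exact hyT

/-- A good set is an ideal such that both it and its complement induce weakly connected
digraphs. -/
def IsGood (D : FinDigraph.{u, v}) (X : Set D.V) : Prop :=
  D.IsIdeal X ∧ D.IsConn X ∧ D.IsConn Xᶜ

lemma IsClosedIn.of_cutEdges_subset {X Y Z : Set D.V} (h : D.cutEdges Y ⊆ D.cutEdges X)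
    (hZ : Z ⊆ X ∨ Z ⊆ Xᶜ) : D.IsClosedIn Y Z := by
  intro e h1 h2
  by_contra h3
  refine mem_cutEdges.1 (h (mem_cutEdges.2 h3)) ?_
  rcases hZ with hZ | hZ
  · exact iff_of_true (hZ h1) (hZ h2)
  · exact iff_of_false (hZ h1) (hZ h2)

lemma cutEdges_nonempty (hD : D.IsConn Set.univ) {X : Set D.V} (h : X.Nonempty)
    (h' : Xᶜ.Nonempty) : (D.cutEdges X).Nonempty := by
  by_contra hne
  obtain ⟨x, hx⟩ := h'
  refine hx (hD.2 X (fun e _ _ => ?_) (by rwa [Set.univ_inter]) (Set.mem_univ x))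
  by_contra he
  exact hne ⟨e, mem_cutEdges.2 he⟩

lemma IsGood.isDirectedBond (hD : D.IsConn Set.univ) {X : Set D.V} (hX : D.IsGood X) :
    D.IsDirectedBond (D.cutEdges X) := by
  obtain ⟨hX, hc, hc'⟩ := hX
  refine isDirectedBond_iff.2 ⟨cutEdges_nonempty hD hc.1 hc'.1, ⟨X, hX, rfl⟩, ?_⟩
  intro Y ⟨e, he⟩ hYX
  have split : ∀ Z, D.IsConn Z → D.IsClosedIn Y Z → Z ⊆ Y ∨ Z ⊆ Yᶜ := by
    intro Z hZ hYZ
    by_cases h : (Z ∩ Y).Nonempty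
    · exact .inl (hZ.2 Y hYZ h)
    · exact .inr fun x hx hxY => h ⟨x, hx, hxY⟩
  have h1 := split X hc (.of_cutEdges_subset hYX (.inl subset_rfl))
  have h2 := split _ hc' (.of_cutEdges_subset hYX (.inr subset_rfl))
  have heX := mem_cutEdges.1 (hYX he)
  rw [mem_cutEdges] at he
  intro f hf
  rw [mem_cutEdges] at hf ⊢
  simp only [Set.subset_def, Set.mem_compl_iff] at h1 h2
  grind

lemma IsDirectedBond.exists_isGood (hD : D.IsConn Set.univ) {S : Set D.E}
    (hS : D.IsDirectedBond S) : ∃ X, D.IsGood X ∧ S = D.cutEdges X := by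
  obtain ⟨⟨e, he⟩, ⟨X, hX, rfl⟩, hmin⟩ := isDirectedBond_iff.1 hS
  have conn : ∀ Z, D.cutEdges Z = D.cutEdges X → Z.Nonempty → Zᶜ.Nonempty → D.IsConn Z := by
    intro Z hZX hne hne'
    refine ⟨hne, fun T hT ⟨x, hxZ, hxT⟩ z hzZ => by_contra fun hzT => ?_⟩
    have sub : ∀ U, D.IsClosedIn U Z → D.cutEdges (Z ∩ U) ⊆ D.cutEdges X := by
      intro U hU f hf
      rw [← hZX]
      rw [mem_cutEdges] at hf ⊢
      have := hU f
      simp only [Set.mem_inter_iff] at hf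
      tauto
    have h1 := hmin (Z ∩ T) (cutEdges_nonempty hD ⟨x, hxZ, hxT⟩
      (hne'.mono (Set.compl_subset_compl.2 Set.inter_subset_left))) (sub T hT)
    obtain ⟨f, hf⟩ := cutEdges_nonempty hD (X := Z ∩ Tᶜ) ⟨z, hzZ, hzT⟩
      (hne'.mono (Set.compl_subset_compl.2 Set.inter_subset_left))
    have hfX := sub _ hT.compl hf
    have hf1 := h1 hfX
    rw [← hZX] at hfX
    rw [mem_cutEdges] at hf hf1 hfX
    simp only [Set.mem_inter_iff, Set.mem_compl_iff] at hf hf1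
    tauto
  have hne : X.Nonempty ∧ Xᶜ.Nonempty := by
    rcases he with he | he
    · exact ⟨⟨_, he.1⟩, ⟨_, he.2⟩⟩
    · exact ⟨⟨_, he.2⟩, ⟨_, he.1⟩⟩
  exact ⟨X, ⟨hX, conn X rfl hne.1 hne.2,
    conn Xᶜ (cutEdges_compl X) hne.2 (by rw [compl_compl]; exact hne.1)⟩, rfl⟩

/-- A connected ideal and a disjoint connected set with no leaving edges are separated by a good
set. -/
lemma exists_isGood_between (hD : D.IsConn Set.univ) {A B : Set D.V} (hA : D.IsConn A)
    (hAi : D.IsIdeal A) (hB : D.IsConn B) (h : Disjoint A B) :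
    ∃ X, D.IsGood X ∧ A ⊆ X ∧ Disjoint X B := by
  obtain ⟨b, hb⟩ := hB.1
  have hBA : B ⊆ Aᶜ := h.subset_compl_left
  obtain ⟨C, hC, hbC⟩ := exists_component (hBA hb)
  have hBC : B ⊆ C := hB.2 C (hC.2.2.mono hBA) ⟨b, hb, hbC⟩
  refine ⟨Cᶜ, ⟨fun e he ht => ?_, ?_, ?_⟩, ?_, ?_⟩
  · by_cases hhA : D.head e ∈ A
    · exact hC.1 ht (hAi e hhA)
    · exact he ((hC.2.2 e (hC.1 ht) hhA).1 ht)
  · exact isConn_compl_of_mem_components hD (by rwa [compl_compl]) hC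
  · rw [compl_compl]; exact hC.2.1
  · exact Set.subset_compl_comm.1 hC.1
  · exact Set.disjoint_left.2 fun x hx hxB => hx (hBC hxB)

lemma exists_isGood_of_not_reaches (hD : D.IsConn Set.univ) {x y : D.V} (h : ¬ D.Reaches x y) :
    ∃ X, D.IsGood X ∧ D.lowerSet y ⊆ X ∧ D.upperSet x ⊆ Xᶜ := by
  obtain ⟨X, hX, h1, h2⟩ := exists_isGood_between hD (isConn_lowerSet y) (isIdeal_lowerSet y)
    (isConn_upperSet x) (Set.disjoint_left.2 fun z hz hz' => h (hz'.trans hz))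
  exact ⟨X, hX, h1, h2.subset_compl_left⟩

section Weight

open Classical in
lemma natCast_ncard_insert_inter {α : Type*} [Finite α] {a : α} {J S : Set α} (ha : a ∉ J) :
    ((insert a J ∩ S).ncard : ZMod 2) = weight (Pi.single a 1) S + ((J ∩ S).ncard : ZMod 2) := by
  rw [weight_single]
  split_ifs with h
  · rw [Set.insert_inter_of_mem h, Set.ncard_insert_of_notMem fun h' => ha h'.1]
    push_cast
    ring
  · rw [Set.insert_inter_of_notMem h, zero_add]

open Classical in
lemma weight_endpoints (e : D.E) (X : Set D.V) :
    weight (Pi.single (D.tail e) 1 + Pi.single (D.head e) 1) X =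
      weight (Pi.single e 1) (D.cutEdges X) := by
  rw [weight_add, weight_single, weight_single, weight_single]
  have h : (1 : ZMod 2) + 1 = 0 := by decide
  by_cases h1 : D.tail e ∈ X <;> by_cases h2 : D.head e ∈ X <;> simp [mem_cutEdges, h1, h2, h]

open Classical in
lemma exists_weight_eq_ncard (J : Set D.E) :
    ∃ w : D.V → ZMod 2, ∀ X, weight w X = ((J ∩ D.cutEdges X).ncard : ZMod 2) := by
  induction J, Set.toFinite J using Set.Finite.induction_on with
  | empty => exact ⟨0, fun X => by simp⟩
  | @insert e J he _ ih =>
    obtain ⟨w, hw⟩ := ih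
    refine ⟨Pi.single (D.tail e) 1 + Pi.single (D.head e) 1 + w, fun X => ?_⟩
    rw [weight_add, weight_endpoints, natCast_ncard_insert_inter he, hw]

/-- The vertex weights that are the degrees modulo two of an edge set. -/
def degreeWeights (D : FinDigraph.{u, v}) : AddSubmonoid (D.V → ZMod 2) where
  carrier := {w | ∃ j : D.E → ZMod 2, ∀ X, weight w X = weight j (D.cutEdges X)}
  zero_mem' := ⟨0, fun X => by simp⟩
  add_mem' := by
    rintro w w' ⟨j, hj⟩ ⟨j', hj'⟩
    exact ⟨j + j', fun X => by rw [weight_add, weight_add, hj, hj']⟩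

open Classical in
lemma mem_degreeWeights (hD : D.IsConn Set.univ) {w : D.V → ZMod 2}
    (hw : weight w Set.univ = 0) : w ∈ D.degreeWeights := by
  have := Fintype.ofFinite D.V
  have two : ∀ f : D.V → ZMod 2, f + f = 0 := fun f => by
    ext; exact CharTwo.add_self_eq_zero _
  obtain ⟨x, -⟩ := hD.1
  have pair : ∀ y, Pi.single x 1 + Pi.single y 1 ∈ D.degreeWeights := by
    intro y
    refine hD.2 {y | Pi.single x 1 + Pi.single y 1 ∈ D.degreeWeights} (fun e _ _ => ?_)
      ⟨x, trivial, by rw [Set.mem_ofPred_eq, two]; exact zero_mem _⟩ (Set.mem_univ y)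
    have he : Pi.single (D.tail e) 1 + Pi.single (D.head e) 1 ∈ D.degreeWeights :=
      ⟨_, weight_endpoints e⟩
    constructor <;> intro h <;> rw [Set.mem_ofPred_eq] at h ⊢ <;>
      convert add_mem h he using 1
    · rw [add_assoc, ← add_assoc (Pi.single (D.tail e) 1), two, zero_add]
    · rw [add_assoc, add_comm (Pi.single (D.tail e) 1), ← add_assoc (Pi.single (D.head e) 1), two,
        zero_add]
  have hsum : w = ∑ y, if w y = 1 then Pi.single x 1 + Pi.single y 1 else 0 := by
    have h01 : ∀ a : ZMod 2, (if a = 1 then 1 else 0) = a := by decide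
    have hw' : ∑ y, w y = 0 := by
      simpa [weight, finsum_eq_sum_of_fintype] using hw
    ext z
    rw [Finset.sum_apply]
    have : ∀ y, (if w y = 1 then Pi.single x 1 + Pi.single y 1 else 0 : D.V → ZMod 2) z =
        w y * (Pi.single x 1 : D.V → ZMod 2) z + w y * (Pi.single y 1 : D.V → ZMod 2) z := by
      intro y
      rw [← mul_add]
      conv_rhs => rw [← h01 (w y)]
      split_ifs <;> simp
    rw [Finset.sum_congr rfl fun y _ => this y, Finset.sum_add_distrib, ← Finset.sum_mul, hw',
      zero_mul, zero_add]
    simp [Pi.single_apply]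
  rw [hsum]
  refine sum_mem fun y _ => ?_
  split_ifs
  · exact pair y
  · exact zero_mem _

lemma hasOddDijoin_of_weight (hD : D.IsConn Set.univ) {w : D.V → ZMod 2}
    (hw : weight w Set.univ = 0) (h : ∀ X, D.IsGood X → weight w X = 1) : D.HasOddDijoin := by
  obtain ⟨j, hj⟩ := mem_degreeWeights hD hw
  refine ⟨{e | j e = 1}, fun S hS => ?_⟩
  obtain ⟨X, hX, rfl⟩ := hS.exists_isGood hD
  rw [← ZMod.natCast_eq_one_iff_odd, ← weight_eq_ncard, ← hj, h X hX]

end Weight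

namespace IsMinimalObstruction

open Classical in
lemma isConn_univ (hD : D.IsMinimalObstruction) : D.IsConn Set.univ := by
  have := hD.nonempty
  refine ⟨Set.univ_nonempty, fun K hK ⟨x, _, hx⟩ => ?_⟩
  by_contra h
  obtain ⟨y, -, hy⟩ := Set.not_subset.1 h
  have edge : ∀ K : Set D.V, D.IsClosedIn K Set.univ → ∀ x ∈ K,
      {e : D.E | D.tail e ∈ K}.Nonempty := by
    intro K hK x hx
    have := hD.not_isIsolated x
    simp only [IsIsolated, not_forall, not_and_or, not_not] at this
    obtain ⟨e, rfl | rfl⟩ := this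
    · exact ⟨e, hx⟩
    · exact ⟨e, (hK e trivial trivial).2 hx⟩
  obtain ⟨J, hJ⟩ := hD.exists_odd_of_disjoint (edge K hK x hx)
  obtain ⟨J', hJ'⟩ := hD.exists_odd_of_disjoint (edge Kᶜ hK.compl y hy)
  refine hD.1 ⟨{e | if D.tail e ∈ K then e ∈ J' else e ∈ J}, fun S hS => ?_⟩
  obtain ⟨⟨e, he⟩, ⟨X, -, rfl⟩, hmin⟩ := isDirectedBond_iff.1 hS
  have side : ∀ K : Set D.V, D.IsClosedIn K Set.univ → D.tail e ∈ K →
      ∀ f ∈ D.cutEdges X, D.tail f ∈ K := by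
    intro K hK heK f hf
    have hcut : ∀ f, f ∈ D.cutEdges (X ∩ K) ↔ f ∈ D.cutEdges X ∧ D.tail f ∈ K := by
      intro f
      have := hK f trivial trivial
      simp only [mem_cutEdges, Set.mem_inter_iff]
      tauto
    exact ((hcut f).1 (hmin (X ∩ K) ⟨e, (hcut e).2 ⟨he, heK⟩⟩ (fun f hf => ((hcut f).1 hf).1)
      hf)).2
  by_cases heK : D.tail e ∈ K
  · have h := side K hK heK
    convert hJ' _ hS (Set.disjoint_left.2 fun f hf hf' => hf' (h f hf)) using 2
    ext f
    by_cases hf : f ∈ D.cutEdges X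
    · simp [hf, h f hf]
    · simp [hf]
  · have h := side Kᶜ hK.compl heK
    convert hJ _ hS (Set.disjoint_left.2 fun f hf hf' => h f hf hf') using 2
    ext f
    by_cases hf : f ∈ D.cutEdges X
    · have : D.tail f ∉ K := h f hf
      simp [hf, this]
    · simp [hf]

lemma exists_weight (hD : D.IsMinimalObstruction) {A : Set D.E} (hA : A.Nonempty) :
    ∃ w : D.V → ZMod 2, weight w Set.univ = 0 ∧
      ∀ X, D.IsGood X → Disjoint (D.cutEdges X) A → weight w X = 1 := by
  obtain ⟨J, hJ⟩ := hD.exists_odd_of_disjoint hA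
  obtain ⟨w, hw⟩ := exists_weight_eq_ncard J
  refine ⟨w, ?_, fun X hX hXA => ?_⟩
  · have : D.cutEdges Set.univ = ∅ := by
      ext e; simp [mem_cutEdges]
    rw [hw, this]
    simp
  · rw [hw, ZMod.natCast_eq_one_iff_odd]
    exact hJ _ (hX.isDirectedBond hD.isConn_univ) hXA

end IsMinimalObstruction

lemma IsGood.of_mem_components_inter (hD : D.IsConn Set.univ) {X Z C : Set D.V}
    (hX : D.IsGood X) (hZ : D.IsGood Z) (h : (X ∪ Z)ᶜ.Nonempty)
    (hC : C ∈ D.components (X ∩ Z)) : D.IsGood C := by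
  refine ⟨fun e he => ?_, hC.2.1, isConn_compl_of_mem_components hD ?_ hC⟩
  · have h1 := hC.1 he
    exact (hC.2.2 e ⟨hX.1 e h1.1, hZ.1 e h1.2⟩ h1).2 he
  · rw [Set.compl_inter]
    exact hX.2.2.union hZ.2.2 (by rwa [← Set.compl_union])

lemma IsGood.compl_of_mem_components_compl_union (hD : D.IsConn Set.univ) {X Z C : Set D.V}
    (hX : D.IsGood X) (hZ : D.IsGood Z) (h : (X ∩ Z).Nonempty)
    (hC : C ∈ D.components (X ∪ Z)ᶜ) : D.IsGood Cᶜ := by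
  refine ⟨fun e he ht => ?_, isConn_compl_of_mem_components hD ?_ hC, ?_⟩
  · have h1 := hC.1 ht
    refine he ((hC.2.2 e h1 fun h2 => h1 ?_).1 ht)
    exact h2.imp (hX.1 e) (hZ.1 e)
  · rw [compl_compl]
    exact hX.2.1.union hZ.2.1 h
  · rw [compl_compl]
    exact hC.2.1

lemma weight_compl {α : Type*} [Finite α] {w : α → ZMod 2} (hw : weight w Set.univ = 0)
    (X : Set α) : weight w Xᶜ = weight w X := by
  have := weight_add_compl w X
  rw [hw] at this
  exact (CharTwo.add_eq_zero.1 this).symm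

lemma weight_add_weight_of_crossing {w : D.V → ZMod 2} (hw : weight w Set.univ = 0)
    {X Z : Set D.V} (h : ∀ C ∈ D.components (X ∩ Z), weight w C = 1)
    (h' : ∀ C ∈ D.components (X ∪ Z)ᶜ, weight w C = 1) :
    weight w X + weight w Z =
      ((D.components (X ∩ Z)).ncard : ZMod 2) + (D.components (X ∪ Z)ᶜ).ncard := by
  rw [← weight_union_add_inter, ← weight_compl hw (X ∪ Z),
    ← weight_sUnion w (pairwiseDisjoint_components _) h,
    ← weight_sUnion w (pairwiseDisjoint_components _) h', sUnion_components, sUnion_components,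
    add_comm]

/-- A good set is non-trivial if both it and its complement span an edge. -/
def IsNontrivialGood (D : FinDigraph.{u, v}) (X : Set D.V) : Prop :=
  D.IsGood X ∧ (∃ e, D.tail e ∈ X ∧ D.head e ∈ X) ∧ ∃ e, D.tail e ∉ X ∧ D.head e ∉ X

/-- Two good sets that cross and whose cuts cover all edges. -/
def IsCoveringPair (D : FinDigraph.{u, v}) (X Z : Set D.V) : Prop :=
  D.IsGood X ∧ D.IsGood Z ∧ (X ∩ Z).Nonempty ∧ (X ∪ Z)ᶜ.Nonempty ∧
    ∀ e, e ∈ D.cutEdges X ∨ e ∈ D.cutEdges Z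

lemma IsCoveringPair.symm {X Z : Set D.V} (h : D.IsCoveringPair X Z) : D.IsCoveringPair Z X :=
  ⟨h.2.1, h.1, Set.inter_comm X Z ▸ h.2.2.1, Set.union_comm X Z ▸ h.2.2.2.1,
    fun e => (h.2.2.2.2 e).symm⟩

namespace IsMinimalObstruction

lemma exists_crossing (hD : D.IsMinimalObstruction) {X : Set D.V} (hX : D.IsNontrivialGood X) :
    ∃ Z, D.IsGood Z ∧ (X ∩ Z).Nonempty ∧ (X ∪ Z)ᶜ.Nonempty ∧ ¬ X ⊆ Z ∧
      ((D.components (X ∩ Z)).ncard : ZMod 2) + (D.components (X ∪ Z)ᶜ).ncard = 1 := by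
  classical
  obtain ⟨hX, h1, h2⟩ := hX
  have hconn := hD.isConn_univ
  obtain ⟨w₁, hw₁, hg₁⟩ := hD.exists_weight (A := {e | D.tail e ∈ X ∧ D.head e ∈ X}) h1
  obtain ⟨w₂, hw₂, hg₂⟩ := hD.exists_weight (A := {e | D.tail e ∉ X ∧ D.head e ∉ X}) h2
  have hin : ∀ Z, D.IsGood Z → Z ⊆ X ∨ Xᶜ ⊆ Z → weight w₂ Z = 1 := by
    intro Z hZ h
    refine hg₂ Z hZ (Set.disjoint_left.2 fun e he he' => mem_cutEdges.1 he ?_)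
    rcases h with h | h
    · exact iff_of_false (fun h' => he'.1 (h h')) fun h' => he'.2 (h h')
    · exact iff_of_true (h he'.1) (h he'.2)
  have hout : ∀ Z, D.IsGood Z → X ⊆ Z ∨ Disjoint X Z → weight w₁ Z = 1 := by
    intro Z hZ h
    refine hg₁ Z hZ (Set.disjoint_left.2 fun e he he' => mem_cutEdges.1 he ?_)
    rcases h with h | h
    · exact iff_of_true (h he'.1) (h he'.2)
    · exact iff_of_false (h.notMem_of_mem_left he'.1) (h.notMem_of_mem_left he'.2)
  let w : D.V → ZMod 2 := fun v => if v ∈ X then w₂ v else w₁ v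
  have hwX : ∀ Z, Z ⊆ X → weight w Z = weight w₂ Z := fun Z hZ =>
    weight_congr fun x hx => if_pos (hZ hx)
  have hwX' : ∀ Z, Disjoint X Z → weight w Z = weight w₁ Z := fun Z hZ =>
    weight_congr fun x hx => if_neg (hZ.notMem_of_mem_right hx)
  have hw : weight w Set.univ = 0 := by
    rw [← weight_add_compl w X, hwX _ subset_rfl, hwX' _ disjoint_compl_right,
      weight_compl hw₁, hin X hX (.inl subset_rfl), hout X hX (.inl subset_rfl)]
    rfl
  have hwin : ∀ Z, D.IsGood Z → Z ⊆ X → weight w Z = 1 := fun Z hZ h => by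
    rw [hwX _ h, hin Z hZ (.inl h)]
  have hwout : ∀ Z, D.IsGood Z → X ⊆ Z → weight w Z = 1 := fun Z hZ h => by
    rw [← weight_compl hw, hwX' _ (Set.disjoint_compl_right_iff_subset.2 h), weight_compl hw₁,
      hout Z hZ (.inl h)]
  obtain ⟨Z, hZ, hwZ⟩ : ∃ Z, D.IsGood Z ∧ weight w Z ≠ 1 := by
    by_contra! h
    exact hD.1 (hasOddDijoin_of_weight hconn hw h)
  have hne : (X ∩ Z).Nonempty := by
    by_contra h
    have h : Disjoint X Z := Set.disjoint_iff_inter_eq_empty.2 (Set.not_nonempty_iff_eq_empty.1 h)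
    exact hwZ (by rw [hwX' _ h, hout Z hZ (.inr h)])
  have hne' : (X ∪ Z)ᶜ.Nonempty := by
    by_contra h
    have h : Xᶜ ⊆ Z := fun x hx => by_contra fun hxZ => h ⟨x, fun h' => h'.elim hx hxZ⟩
    exact hwZ (by rw [← weight_compl hw, hwX _ (Set.compl_subset_comm.1 h), weight_compl hw₂,
      hin Z hZ (.inr h)])
  refine ⟨Z, hZ, hne, hne', fun h => hwZ (hwout Z hZ h), ?_⟩
  rw [← weight_add_weight_of_crossing hw, hwin X hX subset_rfl]
  · have : ∀ a : ZMod 2, a ≠ 1 → 1 + a = 1 := by decide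
    exact this _ hwZ
  · exact fun C hC => hwin C (hX.of_mem_components_inter hconn hZ hne' hC)
      (hC.1.trans Set.inter_subset_left)
  · intro C hC
    rw [← weight_compl hw]
    exact hwout _ (hX.compl_of_mem_components_compl_union hconn hZ hne hC)
      (Set.subset_compl_comm.1 (hC.1.trans (Set.compl_subset_compl.2 Set.subset_union_left)))

lemma exists_isCoveringPair (hD : D.IsMinimalObstruction) {X : Set D.V}
    (hX : D.IsNontrivialGood X) : ∃ Z, D.IsCoveringPair X Z ∧ ¬ X ⊆ Z := by
  obtain ⟨Z, hZ, hne, hne', hXZ, hodd⟩ := hD.exists_crossing hX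
  refine ⟨Z, ⟨hX.1, hZ, hne, hne', fun e => ?_⟩, hXZ⟩
  by_contra! he
  obtain ⟨w, hw, hg⟩ := hD.exists_weight (Set.singleton_nonempty e)
  simp only [Set.disjoint_singleton_right] at hg
  simp only [mem_cutEdges, not_not] at he
  have hconn := hD.isConn_univ
  have := weight_add_weight_of_crossing hw (X := X) (Z := Z) ?_ ?_
  · rw [hodd, hg X hX.1 fun h => mem_cutEdges.1 h he.1,
      hg Z hZ fun h => mem_cutEdges.1 h he.2] at this
    exact absurd this (by decide)
  · refine fun C hC => hg C (hX.1.of_mem_components_inter hconn hZ hne' hC) fun h => ?_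
    refine mem_cutEdges.1 h ⟨fun ht => ?_, fun ht => ?_⟩
    · have := hC.1 ht
      exact (hC.2.2 e this ⟨he.1.1 this.1, he.2.1 this.2⟩).1 ht
    · have := hC.1 ht
      exact (hC.2.2 e ⟨he.1.2 this.1, he.2.2 this.2⟩ this).2 ht
  · intro C hC
    rw [← weight_compl hw]
    refine hg _ (hX.1.compl_of_mem_components_compl_union hconn hZ hne hC) fun h => ?_
    rw [cutEdges_compl] at h
    refine mem_cutEdges.1 h ⟨fun ht => ?_, fun ht => ?_⟩
    · have := hC.1 ht
      exact (hC.2.2 e this fun h => this (h.imp he.1.2 he.2.2)).1 ht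
    · have := hC.1 ht
      exact (hC.2.2 e (fun h => this (h.imp he.1.1 he.2.1)) this).2 ht

lemma exists_tail_or_head (hD : D.IsMinimalObstruction) (x : D.V) :
    (∃ e, D.tail e = x) ∨ ∃ e, D.head e = x := by
  have := hD.not_isIsolated x
  simp only [IsIsolated, not_forall, not_and_or, not_not] at this
  obtain ⟨e, h | h⟩ := this
  · exact .inl ⟨e, h⟩
  · exact .inr ⟨e, h⟩

lemma mem_of_source (hD : D.IsMinimalObstruction) {X Z : Set D.V} (h : D.IsCoveringPair X Z)
    {x : D.V} (hx : ∀ e, D.head e ≠ x) : x ∈ X := by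
  obtain ⟨hX, hZ, ⟨y, hyX, hyZ⟩, -, hcut⟩ := h
  by_contra hxX
  have hout : ∀ e, D.tail e = x → x ∈ Z ∧ D.head e ∉ Z := by
    rintro e rfl
    have h1 : D.head e ∉ X := fun h => hxX (hX.1 e h)
    have h2 := hcut e
    have h3 := hZ.1 e
    simp only [mem_cutEdges] at h2
    tauto
  obtain ⟨e, he⟩ := (hD.exists_tail_or_head x).resolve_right fun ⟨e, he⟩ => hx e he
  have hxZ := (hout e he).1
  have := hZ.2.1.2 {x} (fun e _ h2 => iff_of_false (fun h => (hout e h).2 h2) (hx e))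
    ⟨x, hxZ, rfl⟩ hyZ
  obtain rfl : y = x := this
  exact hxX hyX

lemma notMem_of_sink (hD : D.IsMinimalObstruction) {X Z : Set D.V} (h : D.IsCoveringPair X Z)
    {x : D.V} (hx : ∀ e, D.tail e ≠ x) : x ∉ X := by
  obtain ⟨hX, hZ, -, ⟨y, hy⟩, hcut⟩ := h
  intro hxX
  have hin : ∀ e, D.head e = x → x ∉ Z ∧ D.tail e ∈ Z := by
    rintro e rfl
    have h1 : D.tail e ∈ X := hX.1 e hxX
    have h2 := hcut e
    have h3 := hZ.1 e
    simp only [mem_cutEdges] at h2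
    tauto
  obtain ⟨e, he⟩ := (hD.exists_tail_or_head x).resolve_left fun ⟨e, he⟩ => hx e he
  have hxZ := (hin e he).1
  have := hZ.2.2.2 {x} (fun e h1 _ => iff_of_false (hx e) (fun h => h1 (hin e h).2))
    ⟨x, hxZ, rfl⟩ (fun h => hy (.inr h) : y ∈ Zᶜ)
  obtain rfl : y = x := this
  exact hy (.inl hxX)

lemma exists_isNontrivialGood (hD : D.IsMinimalObstruction) {x y : D.V} (hx : ∃ e, D.tail e = x)
    (hy : ∃ e, D.head e = y) (h : ¬ D.Reaches x y) :
    ∃ X, D.IsNontrivialGood X ∧ x ∉ X ∧ y ∈ X := by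
  obtain ⟨X, hX, h1, h2⟩ := exists_isGood_of_not_reaches hD.isConn_univ h
  obtain ⟨e, rfl⟩ := hx
  obtain ⟨f, rfl⟩ := hy
  exact ⟨X, ⟨hX, ⟨f, h1 (reaches_edge f), h1 .refl⟩, ⟨e, h2 .refl, h2 (reaches_edge e)⟩⟩,
    h2 .refl, h1 .refl⟩

lemma reaches_of_source_or_sink (hD : D.IsMinimalObstruction) {x y : D.V}
    (hx : ∃ e, D.tail e = x) (hy : ∃ e, D.head e = y)
    (h : (∀ e, D.head e ≠ x) ∨ ∀ e, D.tail e ≠ y) : D.Reaches x y := by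
  by_contra hxy
  obtain ⟨X, hX, hxX, hyX⟩ := hD.exists_isNontrivialGood hx hy hxy
  obtain ⟨Z, hZ, -⟩ := hD.exists_isCoveringPair hX
  rcases h with h | h
  · exact hxX (hD.mem_of_source hZ h)
  · exact hD.notMem_of_sink hZ h hyX

end IsMinimalObstruction

/-- A function that assigns three layers to the vertices, such that edges ascend, all pairs of
vertices in different layers are comparable, and the middle layer is non-empty. -/
structure IsLayering (D : FinDigraph.{u, v}) (f : D.V → ℕ) : Prop where
  le_two : ∀ x, f x ≤ 2
  lt : ∀ e, f (D.tail e) < f (D.head e)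
  reaches : ∀ x y, f x < f y → D.Reaches x y
  exists_eq_one : ∃ x, f x = 1

lemma IsMinimalObstruction.exists_isLayering (hD : D.IsMinimalObstruction) :
    ∃ f : D.V → ℕ, D.IsLayering f := by
  classical
  have hiso := hD.exists_tail_or_head
  by_cases H : ∃ X, D.IsNontrivialGood X
  · obtain ⟨X, hX⟩ := H
    obtain ⟨Z, hXZ, hsub⟩ := hD.exists_isCoveringPair hX
    have hsource : ∀ x, (∀ e, D.head e ≠ x) → x ∈ X ∧ x ∈ Z := fun x hx =>
      ⟨hD.mem_of_source hXZ hx, hD.mem_of_source hXZ.symm hx⟩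
    have hsink : ∀ x, (∀ e, D.tail e ≠ x) → x ∉ X ∧ x ∉ Z := fun x hx =>
      ⟨hD.notMem_of_sink hXZ hx, hD.notMem_of_sink hXZ.symm hx⟩
    let f : D.V → ℕ := fun x => (if x ∈ X then 0 else 1) + (if x ∈ Z then 0 else 1)
    have hle : ∀ x, f x ≤ 2 := fun x => by simp only [f]; split_ifs <;> omega
    have hlt : ∀ e, f (D.tail e) < f (D.head e) := by
      intro e
      have h1 := hXZ.1.1 e
      have h2 := hXZ.2.1.1 e
      have h3 := hXZ.2.2.2.2 e
      simp only [mem_cutEdges] at h3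
      simp only [f]
      split_ifs <;> first | omega | tauto
    refine ⟨f, hle, hlt, fun x y hxy => ?_, ?_⟩
    · have hx : ∃ e, D.tail e = x := by
        by_contra! h
        have h1 := hsink x h
        have h2 : f x = 2 := by simp [f, h1]
        have := hle y
        omega
      have hy : ∃ e, D.head e = y := by
        by_contra! h
        have h1 := hsource y h
        have h2 : f y = 0 := by simp [f, h1]
        omega
      refine hD.reaches_of_source_or_sink hx hy ?_
      by_contra! h
      obtain ⟨⟨e, rfl⟩, ⟨e', rfl⟩⟩ := h
      have := hlt e
      have := hlt e'
      have := hle (D.head e')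
      omega
    · obtain ⟨x, hxX, hxZ⟩ := Set.not_subset.1 hsub
      exact ⟨x, by simp [f, hxX, hxZ]⟩
  · have hreach : ∀ x y, (∃ e, D.tail e = x) → (∃ e, D.head e = y) → D.Reaches x y := by
      intro x y hx hy
      by_contra h
      obtain ⟨X, hX, -⟩ := hD.exists_isNontrivialGood hx hy h
      exact H ⟨X, hX⟩
    have hacyc : ∀ e, (∃ e', D.head e' = D.tail e) → ¬ ∃ e', D.tail e' = D.head e :=
      fun e h h' => hD.not_reaches e (hreach _ _ h' h)
    by_cases hm : ∃ x, (∃ e, D.head e = x) ∧ ∃ e, D.tail e = x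
    · let f : D.V → ℕ := fun x =>
        (if ∃ e, D.head e = x then 1 else 0) + (if ∃ e, D.tail e = x then 0 else 1)
      refine ⟨f, fun x => ?_, fun e => ?_, fun x y hxy => ?_, ?_⟩
      · simp only [f]; split_ifs <;> omega
      · have h1 := hacyc e
        have h2 : ∃ e', D.head e' = D.head e := ⟨e, rfl⟩
        have h3 : ∃ e', D.tail e' = D.tail e := ⟨e, rfl⟩
        simp only [f, if_pos h2, if_pos h3]
        split_ifs <;> first | omega | tauto
      · have hx := hiso x
        have hy := hiso y
        refine hreach x y ?_ ?_ <;> by_contra h <;> simp only [f] at hxy <;> split_ifs at hxy <;>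
          first | omega | tauto
      · obtain ⟨x, h1, h2⟩ := hm
        exact ⟨x, by simp only [f, if_pos h1, if_pos h2]⟩
    · let f : D.V → ℕ := fun x => if ∃ e, D.head e = x then 1 else 0
      have hf : ∀ x, 0 < f x ↔ ∃ e, D.head e = x := fun x => by
        simp only [f]; split_ifs with h <;> simp [h]
      have hf1 : ∀ x, f x ≤ 1 := fun x => by simp only [f]; split_ifs <;> omega
      refine ⟨f, fun x => (hf1 x).trans one_le_two, fun e => ?_, fun x y hxy => ?_, ?_⟩
      · have h1 : ¬ 0 < f (D.tail e) := fun h => hm ⟨_, (hf _).1 h, e, rfl⟩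
        have h2 := (hf (D.head e)).2 ⟨e, rfl⟩
        omega
      · have := hf1 y
        refine hreach x y ((hiso x).resolve_right fun h => ?_) ((hf y).1 (by omega))
        have := (hf x).2 h
        omega
      · obtain ⟨x⟩ := hD.nonempty
        have : ∃ e : D.E, True := by
          obtain ⟨e, -⟩ | ⟨e, -⟩ := hiso x <;> exact ⟨e, trivial⟩
        obtain ⟨e, -⟩ := this
        exact ⟨D.head e, if_pos ⟨e, rfl⟩⟩

namespace IsLayering

variable {f : D.V → ℕ}

lemma eq_or_lt (hf : D.IsLayering f) {x y : D.V} (h : D.Reaches x y) : x = y ∨ f x < f y := by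
  induction h with
  | refl => exact .inl rfl
  | tail _ h ih =>
    obtain ⟨e, rfl, rfl⟩ := h
    have := hf.lt e
    rcases ih with rfl | ih
    · exact .inr this
    · exact .inr (ih.trans this)

lemma exists_edge (hf : D.IsLayering f) {x y : D.V} (h : f y = f x + 1) :
    ∃ e, D.tail e = x ∧ D.head e = y := by
  obtain rfl | ⟨z, ⟨e, rfl, rfl⟩, hz⟩ := (hf.reaches x y (by omega)).cases_head
  · omega
  · refine ⟨e, rfl, (hf.eq_or_lt hz).resolve_right ?_⟩
    have := hf.lt e
    omega

lemma head_eq_succ (hf : D.IsLayering f) (hdel : ∀ e, ¬ D.IsDeletable e) (e : D.E) :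
    f (D.head e) = f (D.tail e) + 1 := by
  have h1 := hf.lt e
  have h2 := hf.le_two (D.head e)
  by_contra h
  obtain ⟨m, hm⟩ := hf.exists_eq_one
  obtain ⟨a, ha, ham⟩ := hf.exists_edge (x := D.tail e) (y := m) (by omega)
  obtain ⟨b, hbm, hb⟩ := hf.exists_edge (x := m) (y := D.head e) (by omega)
  refine hdel e ⟨fun h' => h1.ne (congrArg f h'),
    .tail (.single ⟨a, ?_, ha, ham⟩) ⟨b, ?_, hbm, hb⟩⟩
  · rintro rfl
    rw [ham] at h2 h1 h
    omega
  · rintro rfl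
    rw [hbm] at h1 h
    omega

lemma edge_unique (hf : D.IsLayering f) (hdel : ∀ e, ¬ D.IsDeletable e) {e e' : D.E}
    (ht : D.tail e = D.tail e') (hh : D.head e = D.head e') : e = e' := by
  by_contra h
  have := hf.lt e
  refine hdel e ⟨fun h' => ?_, .single ⟨e', Ne.symm h, ht.symm, hh.symm⟩⟩
  rw [h'] at this
  omega

lemma exists_iso (hf : D.IsLayering f) (hdel : ∀ e, ¬ D.IsDeletable e) :
    ∃ n₁ n₂ n₃ : ℕ, Nonempty (D.Iso (layered n₁ n₂ n₃)) := by
  let φ (i : ℕ) : {x // f x = i} ≃ Fin (Nat.card {x // f x = i}) := Finite.equivFin _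
  refine ⟨Nat.card {x // f x = 0}, Nat.card {x // f x = 1}, Nat.card {x // f x = 2}, ?_⟩
  let L := layered (Nat.card {x // f x = 0}) (Nat.card {x // f x = 1}) (Nat.card {x // f x = 2})
  let g : L.V → D.V := Sum.elim (fun a => ((φ 0).symm a).1)
    (Sum.elim (fun a => ((φ 1).symm a).1) (fun a => ((φ 2).symm a).1))
  have hg : g.Bijective := by
    constructor
    · have hφ : ∀ i j a b, ((φ i).symm a).1 = ((φ j).symm b).1 → i = j := fun i j a b h => by
        rw [← ((φ i).symm a).2, h, ((φ j).symm b).2]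
      rintro (a | a | a) (b | b | b) h <;>
        first
        | rw [(φ _).symm.injective (Subtype.ext h)]
        | exact absurd (hφ _ _ _ _ h) (by decide)
    · intro x
      have := hf.le_two x
      obtain h | h | h : f x = 0 ∨ f x = 1 ∨ f x = 2 := by omega
      · exact ⟨.inl (φ 0 ⟨x, h⟩), by simp [g]⟩
      · exact ⟨.inr (.inl (φ 1 ⟨x, h⟩)), by simp [g]⟩
      · exact ⟨.inr (.inr (φ 2 ⟨x, h⟩)), by simp [g]⟩
  have hedge : ∀ p : L.E, ∃ e, D.tail e = g (L.tail p) ∧ D.head e = g (L.head p) := by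
    rintro (p | p)
    · exact hf.exists_edge (x := ((φ 0).symm p.1).1) (y := ((φ 1).symm p.2).1)
        (by rw [((φ 0).symm p.1).2, ((φ 1).symm p.2).2])
    · exact hf.exists_edge (x := ((φ 1).symm p.1).1) (y := ((φ 2).symm p.2).1)
        (by rw [((φ 1).symm p.1).2, ((φ 2).symm p.2).2])
  choose G hGt hGh using hedge
  have hG : G.Bijective := by
    constructor
    · intro p q h
      have ht := hg.1 ((hGt p).symm.trans (h ▸ hGt q))
      have hh := hg.1 ((hGh p).symm.trans (h ▸ hGh q))
      rcases p with ⟨a, b⟩ | ⟨a, b⟩ <;> rcases q with ⟨c, d⟩ | ⟨c, d⟩ <;>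
        simp only [L, layered, Sum.elim_inl, Sum.elim_inr, Sum.inl.injEq, Sum.inr.injEq,
          reduceCtorEq] at ht hh <;> rw [ht, hh]
    · intro e
      have h1 := hf.head_eq_succ hdel e
      have h2 := hf.le_two (D.head e)
      have key : ∀ p, g (L.tail p) = D.tail e → g (L.head p) = D.head e → ∃ p, G p = e :=
        fun p ht hh => ⟨p, hf.edge_unique hdel ((hGt p).trans ht) ((hGh p).trans hh)⟩
      obtain h | h : f (D.tail e) = 0 ∨ f (D.tail e) = 1 := by omega
      · refine key (.inl (φ 0 ⟨D.tail e, h⟩, φ 1 ⟨D.head e, by omega⟩)) ?_ ?_ <;>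
          simp [g, L, layered]
      · refine key (.inr (φ 1 ⟨D.tail e, h⟩, φ 2 ⟨D.head e, by omega⟩)) ?_ ?_ <;>
          simp [g, L, layered]
  let gE := Equiv.ofBijective g hg
  let GE := Equiv.ofBijective G hG
  refine ⟨⟨gE.symm, GE.symm, fun e => ?_, fun e => ?_⟩⟩
  · obtain ⟨p, rfl⟩ := GE.surjective e
    rw [Equiv.symm_apply_apply, Equiv.eq_symm_apply]
    exact (hGt p).symm
  · obtain ⟨p, rfl⟩ := GE.surjective e
    rw [Equiv.symm_apply_apply, Equiv.eq_symm_apply]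
    exact (hGh p).symm

end IsLayering

end FinDigraph

theorem mainTheorem6 (D : FinDigraph.{u, v}) (hD : D.IsMinimalObstruction) :
    ∃ n₁ n₂ n₃ : ℕ, Nonempty (D.Iso (FinDigraph.layered n₁ n₂ n₃)) := by
  obtain ⟨f, hf⟩ := hD.exists_isLayering
  exact hf.exists_iso hD.not_isDeletable
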